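/- There is an absolute constant $c>0$ such that the following holds. Let $K\ge 1$, let $\mu_0,\mu_1,\dots,\mu_K\in[0,1]$ satisfy $\mu_1>\mu_0\ge\mu_2\ge\cdots\ge\mu_K$, and let $\delta\in(0,\tfrac1{16})$. Consider $K$-armed bandits with threshold $\mu_0$. An instance $\nu=(\nu_a)_{a\in[K]}$ assigns to each arm $a$ a reward distribution $\nu_a$ with mean $m_a$ whose centred reward is $1$-sub-Gaussian; it is positive if $\max_a m_a>\mu_0$ and negative if $\max_a m_a<\mu_0$. The correct answers are the arms $a$ with $m_a\ge\mu_0$ if $\nu$ is positive, and only $\mathsf{None}$ if $\nu$ is negative. An algorithm chooses each arm $A_t$ from the history $H(t-1)=(A_s,X_s)_{s<t}$ (possibly at random), observes a reward $X_t\sim\nu_{A_t}$, stops at a (possibly infinite) stopping time $\tau$ of the filtration $(\sigma(H(t)))_t$, and if $\tau<\infty$ outputs $\hat a\in[K]\cup\{\mathsf{None}\}$ as a function of $H(\tau)$. It is $\delta$-PAC if $\Pr_\nu(\tau<\infty,\ \hat a\text{ is a correct answer})>1-\delta$ for every positive or negative instance $\nu$ (with arbitrary real means). Then for every $\delta$-PAC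 algorithm there is a permutation $\sigma$ of $[K]$ such that the instance $\nu$ with reward distributions $\nu_a=N(\mu_{\sigma(a)},1)$, $a\in[K]$, which is positive, satisfies $$\mathbb E_\nu[\tau]\ \ge\ c\,H_1,\qquad H_1=\sum_{a=2}^K\frac{2}{\Delta_{1,a}^2},\quad \Delta_{1,a}=|\mu_1-\mu_a| .$$ In particular the lower bound does not depend on $\delta$. -/

import Mathlib

open MeasureTheory ProbabilityTheory
open scoped ENNReal NNReal

namespace OneIdentification

/-! ### Instances -/

/-- A `K`-armed bandit instance: one reward distribution per arm, whose centred reward is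
`1`-sub-Gaussian. -/
structure BanditInstance (K : ℕ) where
  arm : Fin K → Measure ℝ
  isProbabilityMeasure_arm : ∀ a, IsProbabilityMeasure (arm a)
  subGaussian_arm : ∀ a, HasSubgaussianMGF (fun x => x - ∫ y, y ∂(arm a)) 1 (arm a)

namespace BanditInstance

variable {K : ℕ}

/-- The mean reward of an arm. -/
noncomputable def mean (ν : BanditInstance K) (a : Fin K) : ℝ := ∫ x, x ∂(ν.arm a)

/-- Some arm (equivalently, the best one) has mean above the threshold `θ`. -/
def IsPositive (ν : BanditInstance K) (θ : ℝ) : Prop := ∃ a, θ < ν.mean a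

/-- All arms (equivalently, the best one) have mean below the threshold `θ`. -/
def IsNegative (ν : BanditInstance K) (θ : ℝ) : Prop := ∀ a, ν.mean a < θ

/-- The set of correct answers. On a positive instance these are the arms with mean at least `θ`,
on a negative instance the only one is `none`. -/
def correctAnswers (ν : BanditInstance K) (θ : ℝ) : Set (Option (Fin K)) :=
  {o | (ν.IsPositive θ ∧ ∃ a, o = some a ∧ θ ≤ ν.mean a) ∨ (ν.IsNegative θ ∧ o = none)}

/-- The reward distributions as a Markov kernel from arms to rewards. -/
noncomputable def rewardKernel (ν : BanditInstance K) : Kernel (Fin K) ℝ :=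
  Kernel.ofFunOfCountable ν.arm

instance (ν : BanditInstance K) : IsMarkovKernel ν.rewardKernel :=
  ⟨fun a => ν.isProbabilityMeasure_arm a⟩

end BanditInstance

theorem hasSubgaussianMGF_gaussianReal (m : ℝ) :
    HasSubgaussianMGF (fun x => x - ∫ y, y ∂(gaussianReal m 1)) 1 (gaussianReal m 1) := by
  have hmap : (gaussianReal m 1).map (fun x => x - m) = gaussianReal 0 1 := by
    rw [gaussianReal_map_sub_const, sub_self]
  rw [integral_id_gaussianReal]
  refine ⟨fun t => ?_, fun t => ?_⟩
  · have h := integrable_exp_mul_gaussianReal (μ := 0) (v := 1) t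
    rw [← hmap] at h
    exact h.comp_measurable (by fun_prop)
  · rw [mgf_gaussianReal hmap]
    simp

/-- The instance with unit-variance Gaussian rewards and mean vector `m`. -/
noncomputable def gaussianInstance {K : ℕ} (m : Fin K → ℝ) : BanditInstance K where
  arm a := gaussianReal (m a) 1
  isProbabilityMeasure_arm _ := inferInstance
  subGaussian_arm a := hasSubgaussianMGF_gaussianReal (m a)

/-! ### Pulling strategies -/

/-- A history of `t` rounds: the pulled arm and the observed reward of each round. -/
abbrev History (K t : ℕ) : Type := Fin t → Fin K × ℝ

/-- An infinite run: entry `s` is the pair `(A_{s+1}, X_{s+1})`. -/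
abbrev Run (K : ℕ) : Type := ℕ → Fin K × ℝ

/-- The first `t` rounds of a run. -/
def history {K : ℕ} (t : ℕ) (ω : Run K) : History K t := fun s => ω s

theorem measurable_history {K : ℕ} (t : ℕ) : Measurable (history (K := K) t) :=
  measurable_pi_lambda _ fun s => measurable_pi_apply (s : ℕ)

/-- The filtration `t ↦ σ(H(t))` generated by the first `t` rounds. -/
def historyFiltration (K : ℕ) :
    Filtration ℕ (inferInstance : MeasurableSpace (Run K)) where
  seq t := MeasurableSpace.comap (history t) inferInstance
  mono' := by
    intro t u htu
    have h : (history t : Run K → History K t) =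
        (fun (h : History K u) (s : Fin t) => h (Fin.castLE htu s)) ∘ history u := rfl
    have hm : Measurable (fun (h : History K u) (s : Fin t) => h (Fin.castLE htu s)) :=
      measurable_pi_lambda _ fun s => measurable_pi_apply _
    change MeasurableSpace.comap (history t) _ ≤ MeasurableSpace.comap (history u) _
    rw [h, ← MeasurableSpace.comap_comp]
    exact MeasurableSpace.comap_mono hm.comap_le
  le' t := (measurable_history t).comap_le

/-- A pulling strategy for `K` arms: a sampling rule choosing the next arm from the history
(possibly at random; a deterministic rule is a Dirac kernel), a stopping time of the history
filtration, possibly infinite, and a recommendation rule mapping the history at the stopping time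
to an arm or to `none`. -/
structure Strategy (K : ℕ) where
  sample : (t : ℕ) → Kernel (History K t) (Fin K)
  isMarkovKernel_sample : ∀ t, IsMarkovKernel (sample t)
  stopTime : Run K → ℕ∞
  isStoppingTime_stopTime : IsStoppingTime (historyFiltration K) stopTime
  recommend : (t : ℕ) → History K t → Option (Fin K)
  measurableSet_recommend : ∀ t o, MeasurableSet {h | recommend t h = o}

namespace Strategy

variable {K : ℕ}

instance (alg : Strategy K) (t : ℕ) : IsMarkovKernel (alg.sample t) :=
  alg.isMarkovKernel_sample t

/-- The conditional law of round `t + 1` given the first `t` rounds: an arm drawn by the sampling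
rule, then a reward drawn from the distribution of that arm. -/
noncomputable def roundKernel (alg : Strategy K) (ν : BanditInstance K) (t : ℕ) :
    Kernel (History K t) (Fin K × ℝ) :=
  alg.sample t ⊗ₖ Kernel.prodMkLeft (History K t) ν.rewardKernel

instance (alg : Strategy K) (ν : BanditInstance K) (t : ℕ) :
    IsMarkovKernel (alg.roundKernel ν t) := by
  unfold roundKernel; infer_instance

/-- Reindexing of a history of `n + 1` rounds. -/
def ofIic (n : ℕ) (h : Finset.Iic n → Fin K × ℝ) : History K (n + 1) :=
  fun s => h ⟨s, Finset.mem_Iic.2 (Nat.lt_succ_iff.1 s.isLt)⟩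

theorem measurable_ofIic (n : ℕ) : Measurable (ofIic (K := K) n) :=
  measurable_pi_lambda _ fun _ => measurable_pi_apply _

/-- The law of the run generated by a strategy on an instance (Ionescu-Tulcea). -/
noncomputable def law (alg : Strategy K) (ν : BanditInstance K) : Measure (Run K) :=
  Kernel.trajMeasure (X := fun _ => Fin K × ℝ) (alg.roundKernel ν 0 Fin.elim0)
    fun n => (alg.roundKernel ν (n + 1)).comap (ofIic n) (measurable_ofIic n)

instance (alg : Strategy K) (ν : BanditInstance K) : IsProbabilityMeasure (alg.law ν) := by
  unfold law; infer_instance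

/-- The event that the strategy stops and then recommends an element of `S`. -/
def recommendsIn (alg : Strategy K) (S : Set (Option (Fin K))) : Set (Run K) :=
  {ω | ∃ t : ℕ, alg.stopTime ω = t ∧ alg.recommend t (history t ω) ∈ S}

/-- The `δ`-PAC property for the threshold `θ`: on every positive or negative instance, the strategy
stops with a correct recommendation with probability more than `1 - δ`. -/
def IsPAC (alg : Strategy K) (θ δ : ℝ) : Prop :=
  ∀ ν : BanditInstance K, ν.IsPositive θ ∨ ν.IsNegative θ →
    1 - δ < (alg.law ν).real (alg.recommendsIn (ν.correctAnswers θ))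

/-- The expected stopping time, a value in `[0, ∞]`. -/
noncomputable def expectedStop (alg : Strategy K) (ν : BanditInstance K) : ℝ≥0∞ :=
  ∫⁻ ω, (alg.stopTime ω : ℝ≥0∞) ∂(alg.law ν)

end Strategy

/-- `H₁ = ∑_{a ≥ 2} 2 / Δ_{1,a}²`, where `Δ_{1,a} = |μ₁ - μ_a|` and arm `1` has index `0`. -/
noncomputable def H₁ {K : ℕ} [NeZero K] (μ : Fin K → ℝ) : ℝ :=
  ∑ a ∈ Finset.univ.erase 0, 2 / |μ 0 - μ a| ^ 2

end OneIdentification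

/-! The cost comes from locating the good arm, not from confidence, which is why $\delta$ plays no
role. Fix $j\ne 0$ and two arms $p,q$, both of mean $\mu_j$ in a base vector $u\le\theta$; raising
$p$ or $q$ to $\mu_0$ gives two instances that differ by a swap. Put $\Delta=\mu_0-\mu_j$ and
$b=1/(16\Delta^2)$, and run the strategy on the negative instance $u-\eta$, where it answers `none`
with probability above $15/16$. It cannot do so with $p$ pulled fewer than $b$ times too often,
since that is hard to distinguish from the instance where $p$ is raised and `none` is wrong. So $p$
or $q$ is likely to reach $b$ pulls, and whichever does so first does it while the other is still
undersampled. That event therefore keeps positive probability when the other arm is the raised one: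
there, a bad arm receives $b$ pulls (`IsPAC.le_expectedPulls_add`).

The transfer between instances is `law_real_iUnion_le`, an AM-GM substitute for divergence bounds.
Summing over $j$ and averaging over permutations, which the swap pairs up, gives $H_1$
(`IsPAC.exists_perm_le_expectedStop`). -/

namespace OneIdentification

/-! ### One step of the law of a run -/

namespace Strategy

variable {K : ℕ}

/-- The next round of a run follows the round kernel of the history. -/
theorem lintegral_law_history_step (alg : Strategy K) (ν : BanditInstance K) (t : ℕ)
    {F : History K t × (Fin K × ℝ) → ℝ≥0∞} (hF : Measurable F) :
    ∫⁻ ω, F (history t ω, ω t) ∂(alg.law ν) =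
      ∫⁻ ω, ∫⁻ y, F (history t ω, y) ∂(alg.roundKernel ν t (history t ω)) ∂(alg.law ν) := by
  -- The trajectory measure takes the first round as an initial law rather than as a kernel step, so
  -- round $0$ is separate.
  cases t with
  | zero =>
    have hmap : (alg.law ν).map (fun ω : Run K => ω 0) = alg.roundKernel ν 0 Fin.elim0 := by
      have hle : (alg.law ν).map (Preorder.frestrictLe (π := fun _ => Fin K × ℝ) 0) =
          (alg.roundKernel ν 0 Fin.elim0).map
            (MeasurableEquiv.piUnique fun _ : Finset.Iic 0 => Fin K × ℝ).symm := by
        unfold law Kernel.trajMeasure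
        rw [Measure.map_comp _ _ (by fun_prop), Kernel.traj_map_frestrictLe,
          Kernel.partialTraj_self]
        exact Measure.id_comp
      have heval : (fun ω : Run K => ω 0) =
          (fun x : Finset.Iic 0 → Fin K × ℝ => x default) ∘
            Preorder.frestrictLe (π := fun _ => Fin K × ℝ) 0 := rfl
      rw [heval, ← Measure.map_map (by fun_prop) (by fun_prop), hle,
        Measure.map_map (by fun_prop) (by fun_prop)]
      exact Measure.map_id
    have h0 : ∀ ω : Run K, history 0 ω = Fin.elim0 := fun ω => Subsingleton.elim _ _
    simp only [h0]
    have hF' : Measurable fun y => F (Fin.elim0, y) := hF.comp (by fun_prop)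
    rw [lintegral_const, measure_univ, mul_one, ← hmap, lintegral_map hF' (by fun_prop)]
  | succ n =>
    have h := Kernel.map_frestrictLe_trajMeasure_compProd_eq_map_trajMeasure
      (X := fun _ => Fin K × ℝ) (μ₀ := alg.roundKernel ν 0 Fin.elim0)
      (κ := fun n => (alg.roundKernel ν (n + 1)).comap (ofIic n) (measurable_ofIic n)) (a := n)
    have hG : Measurable fun z : (Finset.Iic n → Fin K × ℝ) × (Fin K × ℝ) =>
        F (ofIic n z.1, z.2) :=
      hF.comp (((measurable_ofIic n).comp measurable_fst).prodMk measurable_snd)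
    have h2 := congrArg (fun m => ∫⁻ z, F (ofIic n z.1, z.2) ∂m) h
    rw [Measure.lintegral_compProd hG, lintegral_map hG (by fun_prop),
      lintegral_map hG.lintegral_kernel_prod_right' (by fun_prop)] at h2
    exact h2.symm

theorem lintegral_roundKernel (alg : Strategy K) (ν : BanditInstance K) (t : ℕ) (h : History K t)
    {f : Fin K × ℝ → ℝ≥0∞} (hf : Measurable f) :
    ∫⁻ y, f y ∂(alg.roundKernel ν t h) =
      ∫⁻ a, ∫⁻ x, f (a, x) ∂(ν.arm a) ∂(alg.sample t h) := by
  unfold roundKernel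
  rw [Kernel.lintegral_compProd _ _ _ hf]
  rfl

end Strategy

/-! ### Likelihood ratios between Gaussian instances -/

/-- The logarithm of the density of `gaussianReal (m + d) 1` with respect to `gaussianReal m 1`. -/
noncomputable def logRatio (m d x : ℝ) : ℝ := d * (x - m) - d ^ 2 / 2

theorem lintegral_gaussianReal_add (m d : ℝ) {f : ℝ → ℝ≥0∞} (hf : Measurable f) :
    ∫⁻ x, f x ∂(gaussianReal (m + d) 1) =
      ∫⁻ x, f x * ENNReal.ofReal (Real.exp (logRatio m d x)) ∂(gaussianReal m 1) := by
  rw [gaussianReal_of_var_ne_zero _ one_ne_zero, gaussianReal_of_var_ne_zero _ one_ne_zero,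
    lintegral_withDensity_eq_lintegral_mul _ (measurable_gaussianPDF _ _) hf,
    lintegral_withDensity_eq_lintegral_mul _ (measurable_gaussianPDF _ _)
      (by unfold logRatio; fun_prop)]
  refine lintegral_congr fun x => ?_
  simp only [Pi.mul_apply]
  rw [mul_comm (f x), ← mul_assoc]
  congr 1
  simp only [gaussianPDF, gaussianPDFReal, logRatio]
  rw [← ENNReal.ofReal_mul (by positivity), mul_assoc _ (Real.exp _), ← Real.exp_add]
  congr 3
  simp only [NNReal.coe_one]
  ring

/-- The log-likelihood ratio of a history, between the Gaussian instances with mean vectors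
`m + d` and `m`. -/
noncomputable def logLikelihood {K : ℕ} (m d : Fin K → ℝ) {t : ℕ} (h : History K t) : ℝ :=
  ∑ s, logRatio (m (h s).1) (d (h s).1) (h s).2

theorem measurable_logRatio_arm {K : ℕ} (m d : Fin K → ℝ) :
    Measurable fun y : Fin K × ℝ => logRatio (m y.1) (d y.1) y.2 := by
  have hm : Measurable m := measurable_of_countable m
  have hd : Measurable d := measurable_of_countable d
  unfold logRatio
  fun_prop

theorem measurable_logLikelihood {K : ℕ} (m d : Fin K → ℝ) (t : ℕ) :
    Measurable (logLikelihood m d : History K t → ℝ) :=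
  Finset.measurable_fun_sum _ fun s _ =>
    (measurable_logRatio_arm m d).comp (measurable_pi_apply s)

theorem logLikelihood_history_succ {K : ℕ} (m d : Fin K → ℝ) (t : ℕ) (ω : Run K) :
    logLikelihood m d (history (t + 1) ω) =
      logLikelihood m d (history t ω) + logRatio (m (ω t).1) (d (ω t).1) (ω t).2 := by
  simp [logLikelihood, history, Fin.sum_univ_castSucc]

namespace Strategy

variable {K : ℕ}

/-- The sampling rule is the same on both instances, so only the reward density contributes. -/
theorem lintegral_roundKernel_gaussian_add (alg : Strategy K) (m d : Fin K → ℝ) (t : ℕ)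
    (h : History K t) {f : Fin K × ℝ → ℝ≥0∞} (hf : Measurable f) :
    ∫⁻ y, f y ∂(alg.roundKernel (gaussianInstance (m + d)) t h) =
      ∫⁻ y, f y * ENNReal.ofReal (Real.exp (logRatio (m y.1) (d y.1) y.2))
        ∂(alg.roundKernel (gaussianInstance m) t h) := by
  have hw := measurable_logRatio_arm m d
  rw [lintegral_roundKernel _ _ _ _ hf, lintegral_roundKernel _ _ _ _ (by fun_prop)]
  refine lintegral_congr fun a => ?_
  exact lintegral_gaussianReal_add (m a) (d a) (f := fun x => f (a, x)) (by fun_prop)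

/-- Change of measure between two Gaussian instances over the first `t` rounds. -/
theorem lintegral_law_gaussian_add (alg : Strategy K) (m d : Fin K → ℝ) (t : ℕ)
    {g : History K t → ℝ≥0∞} (hg : Measurable g) :
    ∫⁻ ω, g (history t ω) ∂(alg.law (gaussianInstance (m + d))) =
      ∫⁻ ω, g (history t ω) * ENNReal.ofReal (Real.exp (logLikelihood m d (history t ω)))
        ∂(alg.law (gaussianInstance m)) := by
  induction t with
  | zero =>
    have h0 : ∀ ω : Run K, history 0 ω = Fin.elim0 := fun ω => Subsingleton.elim _ _
    simp [h0, logLikelihood]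
  | succ t ih =>
    have hsnoc : Measurable fun z : History K t × (Fin K × ℝ) =>
        (Fin.snoc z.1 z.2 : History K (t + 1)) := by
      refine measurable_pi_lambda _ fun s => ?_
      refine Fin.lastCases ?_ (fun i => ?_) s
      · simpa using measurable_snd
      · simp only [Fin.snoc_castSucc]
        exact (measurable_pi_apply i).comp measurable_fst
    have hhist : ∀ ω : Run K, history (t + 1) ω =
        (Fin.snoc (history t ω) (ω t) : History K (t + 1)) := by
      intro ω
      funext s
      refine Fin.lastCases ?_ (fun i => ?_) s <;> simp [history]
    have hG := hg.comp hsnoc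
    have hw := measurable_logRatio_arm m d
    have hl := measurable_logLikelihood m d t
    have e1 := lintegral_law_history_step alg (gaussianInstance (m + d)) t hG
    have e2 := lintegral_law_history_step alg (gaussianInstance m) t
      (F := fun z => g (Fin.snoc z.1 z.2) *
        (ENNReal.ofReal (Real.exp (logRatio (m z.2.1) (d z.2.1) z.2.2)) *
        ENNReal.ofReal (Real.exp (logLikelihood m d z.1))))
      (hG.mul (((hw.comp measurable_snd).exp.ennreal_ofReal).mul
        ((hl.comp measurable_fst).exp.ennreal_ofReal)))
    simp only [Function.comp_def, ← hhist] at e1 e2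
    rw [e1, ih (g := fun h => ∫⁻ y, g (Fin.snoc h y)
      ∂(alg.roundKernel (gaussianInstance (m + d)) t h)) hG.lintegral_kernel_prod_right']
    have e3 : ∀ ω : Run K,
        g (history (t + 1) ω) *
          ENNReal.ofReal (Real.exp (logLikelihood m d (history (t + 1) ω))) =
        g (history (t + 1) ω) *
          (ENNReal.ofReal (Real.exp (logRatio (m (ω t).1) (d (ω t).1) (ω t).2)) *
          ENNReal.ofReal (Real.exp (logLikelihood m d (history t ω)))) := by
      intro ω
      rw [logLikelihood_history_succ, add_comm (logLikelihood _ _ _), Real.exp_add,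
        ENNReal.ofReal_mul (Real.exp_pos _).le]
    simp only [e3]
    rw [e2]
    refine lintegral_congr fun ω => ?_
    have hGω : Measurable fun y => g (Fin.snoc (history t ω) y : History K (t + 1)) :=
      hG.comp (measurable_const.prodMk measurable_id)
    rw [lintegral_roundKernel_gaussian_add _ _ _ _ _ hGω, ← lintegral_mul_const _ (by fun_prop)]
    simp only [mul_assoc]

end Strategy

end OneIdentification
-- Transportation inequality by opposite shifts
namespace OneIdentification

namespace Strategy

variable {K : ℕ}

theorem law_gaussian_add_apply (alg : Strategy K) (m d : Fin K → ℝ) {t : ℕ}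
    {S : Set (History K t)} (hS : MeasurableSet S) :
    alg.law (gaussianInstance (m + d)) (history t ⁻¹' S) =
      ∫⁻ ω in history t ⁻¹' S,
        ENNReal.ofReal (Real.exp (logLikelihood m d (history t ω)))
        ∂(alg.law (gaussianInstance m)) := by
  have hE := measurable_history t hS
  have h := alg.lintegral_law_gaussian_add m d t
    (g := S.indicator 1) (measurable_one.indicator hS)
  rw [← lintegral_indicator_one hE, ← lintegral_indicator hE]
  refine Eq.trans ?_ (h.trans ?_)
  · rfl
  · refine lintegral_congr fun ω => ?_
    by_cases hω : history t ω ∈ S <;> simp [hω]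

end Strategy

/-- The terms linear in the rewards cancel, so the product of the two likelihood ratios depends only
on the arms pulled. -/
theorem logLikelihood_add_neg {K : ℕ} (m d : Fin K → ℝ) {t : ℕ} (h : History K t) :
    logLikelihood m d h + logLikelihood m (-d) h = -∑ s, d (h s).1 ^ 2 := by
  simp only [logLikelihood, logRatio, ← Finset.sum_add_distrib, ← Finset.sum_neg_distrib]
  refine Finset.sum_congr rfl fun s _ => ?_
  simp only [Pi.neg_apply]
  ring

/-- Arithmetic-geometric mean bound for the likelihood ratios of two opposite shifts. -/
theorem two_le_likelihood_add {K : ℕ} (m d : Fin K → ℝ) {t : ℕ} (h : History K t) {L r : ℝ}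
    (hr : 0 < r) (hL : ∑ s, d (h s).1 ^ 2 ≤ L) :
    2 ≤ r * Real.exp (logLikelihood m d h) +
      Real.exp L / r * Real.exp (logLikelihood m (-d) h) := by
  have h1 := logLikelihood_add_neg m d h
  set x := logLikelihood m d h
  have h2 : Real.exp (-x) ≤ Real.exp L * Real.exp (logLikelihood m (-d) h) := by
    rw [← Real.exp_add]
    exact Real.exp_le_exp.2 (by linarith)
  have h3 : Real.exp (-x) / r ≤ Real.exp L / r * Real.exp (logLikelihood m (-d) h) := by
    rw [div_mul_eq_mul_div]
    gcongr
  -- Two positive numbers with product $1$ have sum at least $2$.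
  have h4 : r * Real.exp x * (Real.exp (-x) / r) = 1 := by
    rw [Real.exp_neg]
    field_simp
  have h5 : 0 < r * Real.exp x := by positivity
  have h6 : 0 < Real.exp (-x) / r := by positivity
  nlinarith [sq_nonneg (r * Real.exp x - Real.exp (-x) / r)]

namespace Strategy

variable {K : ℕ}

/-- Integrating the pointwise AM-GM bound over $E$ turns each likelihood ratio into the probability
of $E$ under the shifted instance. -/
theorem two_mul_law_le (alg : Strategy K) (m d : Fin K → ℝ) {t : ℕ} {L r : ℝ} (hr : 0 < r)
    {E : Set (Run K)} (hE : MeasurableSet[historyFiltration K t] E)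
    (hL : ∀ ω ∈ E, ∑ s ∈ Finset.range t, d (ω s).1 ^ 2 ≤ L) :
    2 * alg.law (gaussianInstance m) E ≤
      ENNReal.ofReal r * alg.law (gaussianInstance (m + d)) E +
        ENNReal.ofReal (Real.exp L / r) * alg.law (gaussianInstance (m + -d)) E := by
  obtain ⟨S, hS, rfl⟩ := hE
  have hm : ∀ d : Fin K → ℝ, Measurable fun ω : Run K =>
      ENNReal.ofReal (Real.exp (logLikelihood m d (history t ω))) := fun d =>
    ((measurable_logLikelihood m d t).comp (measurable_history t)).exp.ennreal_ofReal
  rw [law_gaussian_add_apply _ _ _ hS, law_gaussian_add_apply _ _ _ hS,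
    ← lintegral_const_mul _ (hm d), ← lintegral_const_mul _ (hm (-d)),
    ← lintegral_add_left ((hm d).const_mul _), ← setLIntegral_const]
  refine setLIntegral_mono' (measurable_history t hS) fun ω hω => ?_
  rw [← ENNReal.ofReal_mul hr.le, ← ENNReal.ofReal_mul (by positivity),
    ← ENNReal.ofReal_add (by positivity) (by positivity)]
  rw [show (2 : ℝ≥0∞) = ENNReal.ofReal 2 by simp]
  refine ENNReal.ofReal_le_ofReal (two_le_likelihood_add m d _ hr ?_)
  have := hL ω hω
  rwa [Finset.sum_range] at this

/-- Transportation inequality between Gaussian instances for an event decided by a stopping rule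
along which the accumulated information `∑ d²` stays below `L`. -/
theorem law_real_iUnion_le (alg : Strategy K) (m d : Fin K → ℝ) {L r : ℝ} (hr : 0 < r)
    {E : ℕ → Set (Run K)} (hE : ∀ t, MeasurableSet[historyFiltration K t] (E t))
    (hdisj : Pairwise fun s t => Disjoint (E s) (E t))
    (hL : ∀ t, ∀ ω ∈ E t, ∑ s ∈ Finset.range t, d (ω s).1 ^ 2 ≤ L) :
    2 * (alg.law (gaussianInstance m)).real (⋃ t, E t) ≤
      r * (alg.law (gaussianInstance (m + d))).real (⋃ t, E t) + Real.exp L / r := by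
  have hE' : ∀ t, MeasurableSet (E t) := fun t => (historyFiltration K).le t _ (hE t)
  have h : 2 * alg.law (gaussianInstance m) (⋃ t, E t) ≤
      ENNReal.ofReal r * alg.law (gaussianInstance (m + d)) (⋃ t, E t) +
        ENNReal.ofReal (Real.exp L / r) * alg.law (gaussianInstance (m + -d)) (⋃ t, E t) := by
    simp only [measure_iUnion hdisj hE']
    rw [← ENNReal.tsum_mul_left, ← ENNReal.tsum_mul_left, ← ENNReal.tsum_mul_left,
      ← ENNReal.tsum_add]
    exact ENNReal.tsum_le_tsum fun t => alg.two_mul_law_le m d hr (hE t) (hL t)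
  -- The instance shifted by $-d$ is only auxiliary: its probability is bounded by $1$.
  have h' := h.trans (add_le_add_right (mul_le_of_le_one_right' prob_le_one) _)
  have h2 := ENNReal.toReal_mono (by finiteness) h'
  rw [ENNReal.toReal_add (by finiteness) (by finiteness), ENNReal.toReal_mul, ENNReal.toReal_mul,
    ENNReal.toReal_ofReal hr.le, ENNReal.toReal_ofReal (by positivity)] at h2
  simpa [Measure.real] using h2

end Strategy

end OneIdentification
namespace OneIdentification

/-! ### Counting pulls -/

/-- The number of pulls of arm `a` in the first `t` rounds. -/
def pullCount {K : ℕ} (a : Fin K) (t : ℕ) (ω : Run K) : ℕ :=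
  ∑ s ∈ Finset.range t, if (ω s).1 = a then 1 else 0

section PullCount

variable {K : ℕ}

@[simp] theorem pullCount_zero (a : Fin K) (ω : Run K) : pullCount a 0 ω = 0 := rfl

theorem pullCount_succ (a : Fin K) (t : ℕ) (ω : Run K) :
    pullCount a (t + 1) ω = pullCount a t ω + if (ω t).1 = a then 1 else 0 :=
  Finset.sum_range_succ _ _

theorem measurable_round_historyFiltration {s t : ℕ} (hst : s < t) :
    Measurable[historyFiltration K t] fun ω : Run K => ω s :=
  (measurable_pi_apply (X := fun _ : Fin t => Fin K × ℝ) ⟨s, hst⟩).comp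
    (comap_measurable (history (K := K) t))

theorem measurable_pullCount (a : Fin K) {s t : ℕ} (hst : s ≤ t) :
    Measurable[historyFiltration K t] (pullCount a s) := by
  refine Finset.measurable_fun_sum _ fun i hi => ?_
  have hi' := measurable_round_historyFiltration (K := K) ((Finset.mem_range.1 hi).trans_le hst)
  exact Measurable.ite (hi'.fst (measurableSet_singleton a)) measurable_const measurable_const

theorem measurableSet_pullCount_lt (a : Fin K) (b : ℝ) {s t : ℕ} (hst : s ≤ t) :
    MeasurableSet[historyFiltration K t] {ω | (pullCount a s ω : ℝ) < b} :=
  measurable_pullCount a hst (MeasurableSet.of_discrete (s := {n : ℕ | (n : ℝ) < b}))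

/-- Information accumulated over `t` rounds when only arm `a` is shifted by more than `η`. -/
theorem sum_sq_le_pullCount (a : Fin K) {d : Fin K → ℝ} {A η : ℝ}
    (ha : d a ^ 2 ≤ A) (hd : ∀ x, x ≠ a → d x ^ 2 ≤ η) (hη : 0 ≤ η) (t : ℕ) (ω : Run K) :
    ∑ s ∈ Finset.range t, d (ω s).1 ^ 2 ≤ A * pullCount a t ω + η * t := by
  induction t with
  | zero => simp
  | succ t ih =>
    rw [Finset.sum_range_succ, pullCount_succ]
    push_cast
    by_cases h : (ω t).1 = a
    · rw [h, if_pos rfl]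
      linarith
    · have := hd _ h
      rw [if_neg h]
      linarith

end PullCount

namespace Strategy

variable {K : ℕ}

/-- The number of pulls of arm `a` up to the stopping time. -/
noncomputable def totalPulls (alg : Strategy K) (a : Fin K) (ω : Run K) : ℝ≥0∞ :=
  ∑' s : ℕ, if (s : ℕ∞) < alg.stopTime ω ∧ (ω s).1 = a then 1 else 0

/-- The expected number of pulls of arm `a` up to the stopping time. -/
noncomputable def expectedPulls (alg : Strategy K) (ν : BanditInstance K) (a : Fin K) : ℝ≥0∞ :=
  ∫⁻ ω, alg.totalPulls a ω ∂(alg.law ν)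

theorem measurableSet_le_stopTime (alg : Strategy K) (t : ℕ) :
    MeasurableSet[historyFiltration K t] {ω | (t : ℕ∞) ≤ alg.stopTime ω} :=
  alg.isStoppingTime_stopTime.measurableSet_ge t

theorem measurableSet_lt_stopTime (alg : Strategy K) (t : ℕ) :
    MeasurableSet[historyFiltration K t] {ω | (t : ℕ∞) < alg.stopTime ω} :=
  alg.isStoppingTime_stopTime.measurableSet_gt t

theorem measurableSet_stopTime_eq (alg : Strategy K) (t : ℕ) :
    MeasurableSet[historyFiltration K t] {ω | alg.stopTime ω = t} :=
  alg.isStoppingTime_stopTime.measurableSet_eq t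

theorem measurable_totalPulls (alg : Strategy K) (a : Fin K) : Measurable (alg.totalPulls a) := by
  refine Measurable.tsum fun s => ?_
  refine Measurable.ite ?_ measurable_const measurable_const
  exact ((historyFiltration K).le s _ (alg.measurableSet_lt_stopTime s)).inter
    ((measurable_pi_apply (X := fun _ : ℕ => Fin K × ℝ) s).fst (measurableSet_singleton a))

theorem tsum_lt_stopTime_le (n : ℕ∞) :
    (∑' s : ℕ, if (s : ℕ∞) < n then (1 : ℝ≥0∞) else 0) ≤ n := by
  induction n using ENat.recTopCoe with
  | top => simp
  | coe n =>
    rw [tsum_eq_sum (s := Finset.range n) fun s hs => by simpa using hs]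
    simp +contextual only [Nat.cast_lt, Finset.sum_boole]
    exact_mod_cast (Finset.card_filter_le _ _).trans (Finset.card_range n).le

theorem sum_expectedPulls_le (alg : Strategy K) (ν : BanditInstance K) :
    ∑ a, alg.expectedPulls ν a ≤ alg.expectedStop ν := by
  unfold expectedPulls expectedStop
  rw [← lintegral_finsetSum _ fun a _ => alg.measurable_totalPulls a]
  refine lintegral_mono fun ω => ?_
  refine le_trans (le_of_eq ?_) (tsum_lt_stopTime_le (alg.stopTime ω))
  unfold totalPulls
  rw [← Summable.tsum_finsetSum fun _ _ => ENNReal.summable]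
  refine tsum_congr fun s => ?_
  by_cases h : (s : ℕ∞) < alg.stopTime ω <;> simp [h]

theorem pullCount_le_totalPulls (alg : Strategy K) (a : Fin K) {t : ℕ} {ω : Run K}
    (ht : (t : ℕ∞) ≤ alg.stopTime ω) : (pullCount a t ω : ℝ≥0∞) ≤ alg.totalPulls a ω := by
  refine le_trans (le_of_eq ?_) (ENNReal.sum_le_tsum (Finset.range t))
  rw [pullCount, Nat.cast_sum]
  refine Finset.sum_congr rfl fun s hs => ?_
  have : (s : ℕ∞) < alg.stopTime ω := by
    refine lt_of_lt_of_le ?_ ht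
    exact_mod_cast Finset.mem_range.1 hs
  simp [this]

/-- Markov's inequality for the number of pulls. -/
theorem mul_law_le_expectedPulls (alg : Strategy K) (ν : BanditInstance K) (a : Fin K) (b : ℝ)
    {E : Set (Run K)} (hE : MeasurableSet E)
    (h : ∀ ω ∈ E, ∃ t : ℕ, (t : ℕ∞) ≤ alg.stopTime ω ∧ b ≤ pullCount a t ω) :
    ENNReal.ofReal b * alg.law ν E ≤ alg.expectedPulls ν a := by
  rw [← setLIntegral_const]
  refine le_trans (setLIntegral_mono' hE fun ω hω => ?_) (setLIntegral_le_lintegral E _)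
  obtain ⟨t, ht, hb⟩ := h ω hω
  refine le_trans ?_ (alg.pullCount_le_totalPulls a ht)
  rw [← ENNReal.ofReal_natCast]
  exact ENNReal.ofReal_le_ofReal hb

/-! ### The events of the swapping argument -/

/-- Round `t` is the first one at which arm `p` or arm `q` has been pulled `b` times, that arm is
`p`, and the strategy has not stopped before round `t ≤ T`. -/
def reachesFirst (alg : Strategy K) (b : ℝ) (T : ℕ) (p q : Fin K) (t : ℕ) : Set (Run K) :=
  {ω | t ≤ T ∧ (t : ℕ∞) ≤ alg.stopTime ω ∧ ¬ (pullCount p t ω : ℝ) < b ∧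
    (pullCount q t ω : ℝ) < b ∧
    ∀ s < t, (pullCount p s ω : ℝ) < b ∧ (pullCount q s ω : ℝ) < b}

/-- The strategy answers `none` in round `t ≤ T`, or `t = T` and it has not stopped yet, while arm
`p` has been pulled less than `b` times. -/
def undecided (alg : Strategy K) (b : ℝ) (T : ℕ) (p : Fin K) (t : ℕ) : Set (Run K) :=
  {ω | t ≤ T ∧ (pullCount p t ω : ℝ) < b ∧
    ((alg.stopTime ω = t ∧ alg.recommend t (history t ω) = none) ∨
      (t = T ∧ (t : ℕ∞) < alg.stopTime ω))}

theorem measurableSet_reachesFirst (alg : Strategy K) (b : ℝ) (T : ℕ) (p q : Fin K) (t : ℕ) :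
    MeasurableSet[historyFiltration K t] (alg.reachesFirst b T p q t) := by
  refine MeasurableSet.inter (MeasurableSet.const _) <|
    (alg.measurableSet_le_stopTime t).inter <|
    (measurableSet_pullCount_lt p b le_rfl).compl.inter <|
    (measurableSet_pullCount_lt q b le_rfl).inter ?_
  have : {ω : Run K | ∀ s < t, (pullCount p s ω : ℝ) < b ∧ (pullCount q s ω : ℝ) < b} =
      ⋂ s, ⋂ _ : s < t, {ω | (pullCount p s ω : ℝ) < b} ∩ {ω | (pullCount q s ω : ℝ) < b} := by
    ext; simp
  change MeasurableSet[historyFiltration K t]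
    {ω : Run K | ∀ s < t, (pullCount p s ω : ℝ) < b ∧ (pullCount q s ω : ℝ) < b}
  rw [this]
  exact MeasurableSet.iInter fun s => MeasurableSet.iInter fun hs =>
    (measurableSet_pullCount_lt p b hs.le).inter (measurableSet_pullCount_lt q b hs.le)

theorem measurableSet_undecided (alg : Strategy K) (b : ℝ) (T : ℕ) (p : Fin K) (t : ℕ) :
    MeasurableSet[historyFiltration K t] (alg.undecided b T p t) := by
  refine MeasurableSet.inter (MeasurableSet.const _) <|
    (measurableSet_pullCount_lt p b le_rfl).inter <|
    MeasurableSet.union ((alg.measurableSet_stopTime_eq t).inter ?_) <|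
    (MeasurableSet.const _).inter (alg.measurableSet_lt_stopTime t)
  exact ⟨_, alg.measurableSet_recommend t none, rfl⟩

theorem pairwise_disjoint_reachesFirst (alg : Strategy K) (b : ℝ) (T : ℕ) (p q : Fin K) :
    Pairwise fun s t =>
      Disjoint (alg.reachesFirst b T p q s) (alg.reachesFirst b T p q t) := by
  intro s t hst
  rw [Set.disjoint_left]
  rintro ω ⟨-, -, hs, -, hs'⟩ ⟨-, -, ht, -, ht'⟩
  rcases lt_or_gt_of_ne hst with h | h
  · exact hs (ht' s h).1
  · exact ht (hs' t h).1

theorem pairwise_disjoint_undecided (alg : Strategy K) (b : ℝ) (T : ℕ) (p : Fin K) :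
    Pairwise fun s t => Disjoint (alg.undecided b T p s) (alg.undecided b T p t) := by
  intro s t hst
  rw [Set.disjoint_left]
  rintro ω ⟨hs, -, h⟩ ⟨ht, -, h'⟩
  rcases h with ⟨h, -⟩ | ⟨rfl, h⟩ <;> rcases h' with ⟨h', -⟩ | ⟨rfl, h'⟩
  · exact hst (by exact_mod_cast h.symm.trans h')
  · rw [h] at h'
    exact absurd (by exact_mod_cast h') (not_lt.2 hs)
  · rw [h'] at h
    exact absurd (by exact_mod_cast h) (not_lt.2 ht)
  · exact hst rfl

/-- Every run reaches the threshold `b` on `p` or on `q`, or stays undecided, or stops with an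
answer other than `none`. -/
theorem mem_reachesFirst_or (alg : Strategy K) {b : ℝ} (hb : 0 < b) (T : ℕ) {p q : Fin K}
    (hpq : p ≠ q) (ω : Run K) :
    ω ∈ ⋃ t, alg.reachesFirst b T p q t ∨ ω ∈ ⋃ t, alg.reachesFirst b T q p t ∨
      ω ∈ ⋃ t, alg.undecided b T p t ∨ ω ∉ alg.recommendsIn {none} := by
  classical
  simp only [Set.mem_iUnion]
  by_cases hex : ∃ t : ℕ, t ≤ T ∧ (t : ℕ∞) ≤ alg.stopTime ω ∧
      ¬ ((pullCount p t ω : ℝ) < b ∧ (pullCount q t ω : ℝ) < b)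
  · obtain ⟨h1, h2, h3⟩ := Nat.find_spec hex
    have hmin := fun s => Nat.find_min hex (m := s)
    set t := Nat.find hex
    have hlt : ∀ s < t, (pullCount p s ω : ℝ) < b ∧ (pullCount q s ω : ℝ) < b := by
      intro s hs
      by_contra hcon
      refine hmin s hs ⟨hs.le.trans h1, le_trans ?_ h2, hcon⟩
      exact_mod_cast hs.le
    by_cases hp : (pullCount p t ω : ℝ) < b
    · exact Or.inr (Or.inl ⟨t, h1, h2, fun hq => h3 ⟨hp, hq⟩, hp, fun s hs => (hlt s hs).symm⟩)
    · refine Or.inl ⟨t, h1, h2, hp, ?_, hlt⟩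
      clear_value t
      cases t with
      | zero => simpa using hb
      | succ s =>
        have hs := hlt s (Nat.lt_succ_self s)
        rw [pullCount_succ] at hp ⊢
        -- A round pulls a single arm, so when the count of $p$ crosses $b$ that of $q$ does not
        -- move.
        have hω : (ω s).1 = p := by
          by_contra hne
          rw [if_neg hne] at hp
          exact hp hs.1
        rw [if_neg (by rw [hω]; exact hpq)]
        exact hs.2
  · right; right
    have hlt : ∀ t : ℕ, t ≤ T → (t : ℕ∞) ≤ alg.stopTime ω → (pullCount p t ω : ℝ) < b := by
      intro t h1 h2
      by_contra hcon
      exact hex ⟨t, h1, h2, fun h => hcon h.1⟩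
    rcases lt_or_ge (T : ℕ∞) (alg.stopTime ω) with hT | hT
    · exact Or.inl ⟨T, le_rfl, hlt T le_rfl hT.le, Or.inr ⟨rfl, hT⟩⟩
    · by_cases hr : ω ∈ alg.recommendsIn {none}
      · obtain ⟨t, ht, hrt⟩ := hr
        rw [ht] at hT
        have hT' : t ≤ T := by exact_mod_cast hT
        exact Or.inl ⟨t, hT', hlt t hT' ht.ge, Or.inl ⟨ht, hrt⟩⟩
      · exact Or.inr hr

end Strategy

end OneIdentification
-- Consequences of the PAC property, swapping and averaging
namespace OneIdentification

theorem mean_gaussianInstance {K : ℕ} (m : Fin K → ℝ) (a : Fin K) :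
    (gaussianInstance m).mean a = m a :=
  integral_id_gaussianReal

namespace Strategy

variable {K : ℕ}

theorem recommendsIn_mono (alg : Strategy K) {S S' : Set (Option (Fin K))} (h : S ⊆ S') :
    alg.recommendsIn S ⊆ alg.recommendsIn S' := fun _ ⟨t, ht, hr⟩ => ⟨t, ht, h hr⟩

theorem IsPAC.lt_law_real_recommendsIn_none {alg : Strategy K} {θ δ : ℝ} (h : alg.IsPAC θ δ)
    {ν : BanditInstance K} (hν : ν.IsNegative θ) :
    1 - δ < (alg.law ν).real (alg.recommendsIn {none}) := by
  refine (h ν (Or.inr hν)).trans_le (measureReal_mono (alg.recommendsIn_mono ?_))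
  rintro o (⟨⟨a, ha⟩, -⟩ | ⟨-, rfl⟩)
  · exact absurd (hν a) ha.not_gt
  · rfl

/-- On a positive instance, a PAC strategy answers an arm within some fixed number of rounds, with
probability more than `1 - δ`. -/
theorem IsPAC.exists_horizon {alg : Strategy K} {θ δ : ℝ} (h : alg.IsPAC θ δ)
    {ν : BanditInstance K} (hν : ν.IsPositive θ) :
    ∃ T : ℕ, 1 - δ < (alg.law ν).real
      {ω | ∃ t ≤ T, alg.stopTime ω = t ∧ alg.recommend t (history t ω) ≠ none} := by
  set F : ℕ → Set (Run K) := fun T =>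
    {ω | ∃ t ≤ T, alg.stopTime ω = t ∧ alg.recommend t (history t ω) ≠ none}
  have hmono : Monotone F := fun T T' hT ω ⟨t, ht, hω⟩ => ⟨t, ht.trans hT, hω⟩
  have hsub : alg.recommendsIn (ν.correctAnswers θ) ⊆ ⋃ T, F T := by
    rintro ω ⟨t, ht, ⟨-, a, ha, -⟩ | ⟨hneg, -⟩⟩
    · exact Set.mem_iUnion.2 ⟨t, t, le_rfl, ht, by rw [ha]; exact Option.some_ne_none a⟩
    · obtain ⟨a, ha⟩ := hν
      exact absurd (hneg a) ha.not_gt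
  have hlt := (h ν (Or.inl hν)).trans_le (measureReal_mono hsub)
  have htend : Filter.Tendsto (fun T => (alg.law ν).real (F T)) Filter.atTop
      (nhds ((alg.law ν).real (⋃ T, F T))) :=
    (ENNReal.tendsto_toReal (measure_ne_top _ _)).comp (tendsto_measure_iUnion_atTop hmono)
  exact (htend.eventually (lt_mem_nhds hlt)).exists

/-- An undecided run has not answered an arm by round $T$, so it lies outside the event of `hT`. -/
theorem law_real_undecided_lt (alg : Strategy K) {ν : BanditInstance K} {δ b : ℝ} {T : ℕ}
    {p : Fin K} (hT : 1 - δ < (alg.law ν).real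
      {ω | ∃ t ≤ T, alg.stopTime ω = t ∧ alg.recommend t (history t ω) ≠ none}) :
    (alg.law ν).real (⋃ t, alg.undecided b T p t) < δ := by
  have hmeas : MeasurableSet (⋃ t, alg.undecided b T p t) :=
    MeasurableSet.iUnion fun t => (historyFiltration K).le t _ (alg.measurableSet_undecided b T p t)
  have hd : Disjoint (⋃ t, alg.undecided b T p t)
      {ω | ∃ t ≤ T, alg.stopTime ω = t ∧ alg.recommend t (history t ω) ≠ none} := by
    rw [Set.disjoint_left]
    rintro ω hω ⟨t, ht, hτ, hr⟩
    obtain ⟨s, hs, -, ⟨hτ', hr'⟩ | ⟨rfl, hτ'⟩⟩ := Set.mem_iUnion.1 hω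
    · obtain rfl : s = t := by exact_mod_cast hτ'.symm.trans hτ
      exact hr hr'
    · rw [hτ] at hτ'
      exact absurd (by exact_mod_cast hτ') (not_lt.2 ht)
  have h := measureReal_union' (μ := alg.law ν) hd hmeas
  have h1 : (alg.law ν).real ((⋃ t, alg.undecided b T p t) ∪
      {ω | ∃ t ≤ T, alg.stopTime ω = t ∧ alg.recommend t (history t ω) ≠ none}) ≤ 1 :=
    measureReal_le_one
  linarith

/-- Transportation from the instance where arm `g` is raised to mean `M` to the instance where all
means are `u - η`, for an event on which `g` is pulled less than `b` times. -/
theorem law_real_sub_le_update (alg : Strategy K) (u : Fin K → ℝ) (M : ℝ) (g : Fin K) {η b r : ℝ}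
    {T : ℕ} (hr : 0 < r) (hη : 0 ≤ η) (hηM : η ≤ M - u g) (hηT : η ^ 2 * T ≤ 1 / 4)
    (hb : b * (16 * (M - u g) ^ 2) ≤ 1)
    {E : ℕ → Set (Run K)} (hE : ∀ t, MeasurableSet[historyFiltration K t] (E t))
    (hdisj : Pairwise fun s t => Disjoint (E s) (E t))
    (hET : ∀ t, ∀ ω ∈ E t, t ≤ T ∧ (pullCount g t ω : ℝ) < b) :
    2 * (alg.law (gaussianInstance fun a => u a - η)).real (⋃ t, E t) ≤
      r * (alg.law (gaussianInstance (Function.update u g M))).real (⋃ t, E t) + 2 / r := by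
  set m : Fin K → ℝ := fun a => u a - η
  set d : Fin K → ℝ := Function.update u g M - m
  have hmd : Function.update u g M = m + d := by simp [d]
  have hdg : d g ^ 2 ≤ 4 * (M - u g) ^ 2 := by
    have : d g = (M - u g) + η := by simp [d, m]; ring
    rw [this]
    nlinarith
  have hd : ∀ a, a ≠ g → d a ^ 2 ≤ η ^ 2 := by
    intro a ha
    simp [d, m, ha]
  have hexp : Real.exp (1 / 2) ≤ 2 := by
    have h1 : Real.exp (1 / 2) ^ 2 = Real.exp 1 := by
      rw [← Real.exp_nat_mul]; norm_num
    nlinarith [Real.exp_one_lt_d9, Real.exp_pos (1 / 2)]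
  -- The information budget is $1/4$ for fewer than $b$ pulls of $g$ with squared shift at most
  -- $4(M-u_g)^2$, plus $1/4$ for at most $T$ rounds with squared shift $\eta^2$.
  have key := alg.law_real_iUnion_le m d hr hE hdisj (L := 1 / 2) (by
    intro t ω hω
    obtain ⟨ht, hg⟩ := hET t ω hω
    refine (sum_sq_le_pullCount g hdg hd (sq_nonneg η) t ω).trans ?_
    have h1 : 4 * (M - u g) ^ 2 * pullCount g t ω ≤ 4 * (M - u g) ^ 2 * b := by gcongr
    have h2 : η ^ 2 * t ≤ η ^ 2 * T := by gcongr
    nlinarith)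
  rw [hmd]
  refine key.trans ?_
  gcongr

/-- If raising arm `p` and raising arm `q` to the mean `M > θ` are both plausible, then on one of
the two instances the strategy pulls the wrong one of `p`, `q` often. -/
theorem IsPAC.le_expectedPulls_add {alg : Strategy K} {θ δ : ℝ} (h : alg.IsPAC θ δ)
    (hδ : δ < 1 / 16) {u : Fin K → ℝ} (hu : ∀ a, u a ≤ θ) {M : ℝ} (hM : θ < M) {p q : Fin K}
    (hpq : p ≠ q) (hupq : u p = u q) :
    ENNReal.ofReal (5 / 64 * (1 / (16 * (M - u p) ^ 2))) ≤
      alg.expectedPulls (gaussianInstance (Function.update u p M)) q +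
        alg.expectedPulls (gaussianInstance (Function.update u q M)) p := by
  have hΔ : 0 < M - u p := by linarith [hu p]
  set b : ℝ := 1 / (16 * (M - u p) ^ 2) with hbdef
  have hb : 0 < b := by positivity
  have hbΔ : b * (16 * (M - u p) ^ 2) ≤ 1 := by
    rw [hbdef, one_div, inv_mul_cancel₀ (by positivity)]
  have hpos : (gaussianInstance (Function.update u p M)).IsPositive θ :=
    ⟨p, by simpa [mean_gaussianInstance] using hM⟩
  obtain ⟨T, hT⟩ := h.exists_horizon hpos
  have hU := (alg.law_real_undecided_lt (b := b) (p := p) hT).trans hδ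
  -- Means in $u$ may equal $\theta$, so a strict decrease is needed for a negative instance.
  -- Choosing $\eta$ after the horizon $T$ keeps its total information small.
  obtain ⟨η, hη, hηΔ, hηT⟩ : ∃ η : ℝ, 0 < η ∧ η ≤ M - u p ∧ η ^ 2 * T ≤ 1 / 4 := by
    refine ⟨min (M - u p) (1 / (2 * (T + 1))), lt_min hΔ (by positivity), min_le_left _ _, ?_⟩
    have h1 : (min (M - u p) (1 / (2 * ((T : ℝ) + 1)))) ^ 2 ≤ (1 / (2 * ((T : ℝ) + 1))) ^ 2 := by
      have : 0 < min (M - u p) (1 / (2 * ((T : ℝ) + 1))) := lt_min hΔ (by positivity)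
      gcongr
      exact min_le_right _ _
    calc _ ≤ (1 / (2 * ((T : ℝ) + 1))) ^ 2 * T := by gcongr
      _ ≤ 1 / 4 := by
        rw [div_pow, div_mul_eq_mul_div, div_le_div_iff₀ (by positivity) (by positivity)]
        nlinarith [(Nat.cast_nonneg T : (0 : ℝ) ≤ T)]
  have hneg : (gaussianInstance fun a => u a - η).IsNegative θ := fun a => by
    rw [mean_gaussianInstance]
    linarith [hu a]
  have hnone := h.lt_law_real_recommendsIn_none hneg
  set A := ⋃ t, alg.reachesFirst b T p q t
  set B := ⋃ t, alg.reachesFirst b T q p t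
  set C := ⋃ t, alg.undecided b T p t
  have hcover : (alg.law (gaussianInstance fun a => u a - η)).real (alg.recommendsIn {none}) ≤
      (alg.law (gaussianInstance fun a => u a - η)).real A +
      ((alg.law (gaussianInstance fun a => u a - η)).real B +
      (alg.law (gaussianInstance fun a => u a - η)).real C) := by
    have hsub : alg.recommendsIn {none} ⊆ A ∪ (B ∪ C) := by
      intro ω hω
      rcases alg.mem_reachesFirst_or hb T hpq ω with h | h | h | h
      · exact Or.inl h
      · exact Or.inr (Or.inl h)
      · exact Or.inr (Or.inr h)
      · exact absurd hω h
    refine (measureReal_mono hsub).trans ((measureReal_union_le _ _).trans ?_)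
    gcongr
    exact measureReal_union_le _ _
  -- With $P_0$ the law under $u-\eta$ and $P_p,P_q$ those with $p$, $q$ raised, these choices of
  -- $r$ give $P_0(A)\le 4P_q(A)+1/8$, $P_0(B)\le 4P_p(B)+1/8$ and $P_0(C)\le 2P_p(C)+1/4<3/8$.
  -- Since $P_0(A)+P_0(B)+P_0(C)>15/16$, it follows that $P_q(A)+P_p(B)>5/64$.
  have hA := alg.law_real_sub_le_update u M q (r := 8) (T := T) (by norm_num) hη.le
    (hupq ▸ hηΔ) hηT (hupq ▸ hbΔ) (alg.measurableSet_reachesFirst b T p q)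
    (alg.pairwise_disjoint_reachesFirst b T p q) fun t ω hω => ⟨hω.1, hω.2.2.2.1⟩
  have hB := alg.law_real_sub_le_update u M p (r := 8) (T := T) (by norm_num) hη.le
    hηΔ hηT hbΔ (alg.measurableSet_reachesFirst b T q p)
    (alg.pairwise_disjoint_reachesFirst b T q p) fun t ω hω => ⟨hω.1, hω.2.2.2.1⟩
  have hC := alg.law_real_sub_le_update u M p (r := 4) (T := T) (by norm_num) hη.le
    hηΔ hηT hbΔ (alg.measurableSet_undecided b T p)
    (alg.pairwise_disjoint_undecided b T p) fun t ω hω => ⟨hω.1, hω.2.1⟩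
  have hmeas : ∀ p q : Fin K, MeasurableSet (⋃ t, alg.reachesFirst b T p q t) := fun p q =>
    MeasurableSet.iUnion fun t =>
      (historyFiltration K).le t _ (alg.measurableSet_reachesFirst b T p q t)
  have hreach : ∀ p q : Fin K, ∀ ω ∈ ⋃ t, alg.reachesFirst b T p q t,
      ∃ t : ℕ, (t : ℕ∞) ≤ alg.stopTime ω ∧ b ≤ pullCount p t ω := by
    intro p q ω hω
    obtain ⟨t, -, ht, hpt, -⟩ := Set.mem_iUnion.1 hω
    exact ⟨t, ht, not_lt.1 hpt⟩
  refine le_trans ?_ (add_le_add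
    (alg.mul_law_le_expectedPulls (gaussianInstance (Function.update u p M)) q b
      (hmeas q p) (hreach q p))
    (alg.mul_law_le_expectedPulls (gaussianInstance (Function.update u q M)) p b
      (hmeas p q) (hreach p q)))
  rw [← ofReal_measureReal, ← ofReal_measureReal, ← mul_add,
    ← ENNReal.ofReal_add measureReal_nonneg measureReal_nonneg, ← ENNReal.ofReal_mul hb.le,
    mul_comm]
  refine ENNReal.ofReal_le_ofReal ?_
  gcongr
  linarith

/-- Averaging the pulls of the arm with mean `μ j`, over all `j ≠ 0` and all permutations of the
arms, yields a permutation on which the strategy is slow. -/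
theorem IsPAC.exists_perm_le_expectedStop [NeZero K] {alg : Strategy K} {θ δ : ℝ}
    (h : alg.IsPAC θ δ) (hδ : δ < 1 / 16) {μ : Fin K → ℝ} (hμ0 : θ < μ 0)
    (hμ : ∀ a, a ≠ 0 → μ a ≤ θ) :
    ∃ σ : Equiv.Perm (Fin K), ENNReal.ofReal (5 / 4096 * H₁ μ) ≤
      alg.expectedStop (gaussianInstance (μ ∘ σ)) := by
  set β : Fin K → ℝ≥0∞ := fun j => ENNReal.ofReal (5 / 64 * (1 / (16 * (μ 0 - μ j) ^ 2)))
  set f : Equiv.Perm (Fin K) → Fin K → ℝ≥0∞ := fun σ j =>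
    alg.expectedPulls (gaussianInstance (μ ∘ σ)) (σ.symm j)
  have hpair : ∀ j, j ≠ 0 → ∀ σ, β j ≤ f σ j + f (Equiv.swap 0 j * σ) j := by
    intro j hj σ
    -- Demoting the best arm to $\mu_j$ makes it a twin of the arm of index $j$; raising either twin
    -- to $\mu_0$ gives $\mu\circ\sigma$ or its swap.
    set u : Fin K → ℝ := Function.update (μ ∘ σ) (σ.symm 0) (μ j)
    have hne : σ.symm 0 ≠ σ.symm j := fun he => hj (σ.symm.injective he).symm
    have hup : u (σ.symm 0) = μ j := by simp [u]
    have huq : u (σ.symm j) = μ j := by simp [u, hne.symm]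
    have hu : ∀ a, u a ≤ θ := by
      intro a
      by_cases ha : a = σ.symm 0
      · rw [ha, hup]; exact hμ j hj
      · simp only [u, Function.update_of_ne ha, Function.comp]
        exact hμ _ fun h0 => ha (by rw [← h0, Equiv.symm_apply_apply])
    have key := h.le_expectedPulls_add hδ hu hμ0 hne (hup.trans huq.symm)
    have e1 : Function.update u (σ.symm 0) (μ 0) = μ ∘ σ := by
      ext a
      by_cases ha : a = σ.symm 0
      · simp [ha]
      · simp [u, ha]
    have e2 : Function.update u (σ.symm j) (μ 0) = μ ∘ (Equiv.swap 0 j * σ) := by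
      ext a
      by_cases ha : a = σ.symm j
      · simp [ha]
      · by_cases ha' : a = σ.symm 0
        · simp [ha', hne, hup]
        · have h1 : σ a ≠ 0 := fun h0 => ha' (by rw [← h0, Equiv.symm_apply_apply])
          have h2 : σ a ≠ j := fun h0 => ha (by rw [← h0, Equiv.symm_apply_apply])
          simp [u, ha, ha', Equiv.swap_apply_of_ne_of_ne h1 h2]
    have e3 : (Equiv.swap 0 j * σ).symm j = σ.symm 0 := by
      rw [Equiv.symm_apply_eq]
      simp
    rw [hup, e1, e2] at key
    simpa only [f, e3] using key
  have hsum : ∑ σ : Equiv.Perm (Fin K), ∑ j ∈ Finset.univ.erase 0, β j ≤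
      ∑ σ : Equiv.Perm (Fin K), ∑ j ∈ Finset.univ.erase 0, 2 * f σ j := by
    rw [Finset.sum_comm, Finset.sum_comm (f := fun σ j => 2 * f σ j)]
    refine Finset.sum_le_sum fun j hj => ?_
    calc ∑ _σ : Equiv.Perm (Fin K), β j
        ≤ ∑ σ : Equiv.Perm (Fin K), (f σ j + f (Equiv.swap 0 j * σ) j) :=
          Finset.sum_le_sum fun σ _ => hpair j (Finset.ne_of_mem_erase hj) σ
      _ = ∑ σ : Equiv.Perm (Fin K), 2 * f σ j := by
          -- Left multiplication by the swap permutes the group, so both halves of the pair have the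
          -- same total.
          have hmul := Equiv.sum_comp (Equiv.mulLeft (Equiv.swap 0 j)) fun σ => f σ j
          simp only [Equiv.coe_mulLeft] at hmul
          rw [Finset.sum_add_distrib, hmul, ← Finset.sum_add_distrib]
          simp only [two_mul]
  obtain ⟨σ, -, hmax⟩ := Finset.exists_max_image Finset.univ
    (fun σ : Equiv.Perm (Fin K) => ∑ j ∈ Finset.univ.erase 0, 2 * f σ j) Finset.univ_nonempty
  have hσ := hsum.trans (Finset.sum_le_card_nsmul _ _ _ hmax)
  rw [Finset.sum_const, nsmul_eq_mul, nsmul_eq_mul, ENNReal.mul_le_mul_iff_right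
    (by simp) (ENNReal.natCast_ne_top _)] at hσ
  refine ⟨σ, ?_⟩
  have hpulls : ∑ j ∈ Finset.univ.erase 0, f σ j ≤
      alg.expectedStop (gaussianInstance (μ ∘ σ)) := by
    refine le_trans ?_ (alg.sum_expectedPulls_le (gaussianInstance (μ ∘ σ)))
    rw [← σ.symm.sum_comp fun a => alg.expectedPulls (gaussianInstance (μ ∘ σ)) a]
    exact Finset.sum_le_sum_of_subset (Finset.erase_subset _ _)
  rw [← Finset.mul_sum] at hσ
  -- Each $\beta_j$ is $\frac{5}{1024}\Delta_{1,j}^{-2}$, that is, $\frac{5}{2048}$ times the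
  -- corresponding term of $H_1$; pairing permutations costs the remaining factor $2$.
  have hβ : ∑ j ∈ Finset.univ.erase 0, β j = 2 * ENNReal.ofReal (5 / 4096 * H₁ μ) := by
    rw [← ENNReal.ofReal_sum_of_nonneg fun j _ => by positivity,
      show (2 : ℝ≥0∞) = ENNReal.ofReal 2 by simp, ← ENNReal.ofReal_mul (by norm_num), H₁,
      Finset.mul_sum, Finset.mul_sum]
    congr 1
    refine Finset.sum_congr rfl fun j _ => ?_
    rw [sq_abs, mul_comm 16, ← div_div]
    ring
  rw [hβ] at hσ
  exact ((ENNReal.mul_le_mul_iff_right (by norm_num) (by norm_num)).1 hσ).trans hpulls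

end Strategy

end OneIdentification

theorem mainTheorem5 :
    ∃ c : ℝ, 0 < c ∧
      ∀ (K : ℕ) [NeZero K] (θ : ℝ) (μ : Fin K → ℝ),
        θ ∈ Set.Icc (0 : ℝ) 1 → (∀ a, μ a ∈ Set.Icc (0 : ℝ) 1) →
        θ < μ 0 → (∀ a, a ≠ 0 → μ a ≤ θ) → Antitone μ →
        ∀ δ : ℝ, 0 < δ → δ < 1 / 16 →
        ∀ alg : OneIdentification.Strategy K, alg.IsPAC θ δ →
          ∃ σ : Equiv.Perm (Fin K),
            (OneIdentification.gaussianInstance (μ ∘ σ)).IsPositive θ ∧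
            ENNReal.ofReal (c * OneIdentification.H₁ μ) ≤
              alg.expectedStop (OneIdentification.gaussianInstance (μ ∘ σ)) := by
  refine ⟨5 / 4096, by norm_num, ?_⟩
  intro K _ θ μ _ _ hμ0 hμ _ δ _ hδ alg halg
  obtain ⟨σ, hσ⟩ := halg.exists_perm_le_expectedStop hδ hμ0 hμ
  refine ⟨σ, ⟨σ.symm 0, ?_⟩, hσ⟩
  rw [OneIdentification.mean_gaussianInstance]
  simpa using hμ0
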